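/- For a finite graph $G$ on $n$ vertices, let $\mathbf I(G)$ be the random greedy independent set: the vertices are inspected one by one in a uniformly random order, and the current vertex is added to $\mathbf I(G)$ if it is not adjacent to any previously added vertex. Put $\iota(G)=|\mathbf I(G)|/n$. For a random rooted graph $(U,\rho)$, let $\sigma=(\sigma_v)_{v\in V(U)}$ be labels that are, given $U$, independent and uniform on $[0,1]$. The past $\mathcal P_\rho$ of the root is the set of vertices reachable from $\rho$ by a path along which the labels strictly decrease (with $\rho\in\mathcal P_\rho$). If $\mathcal P_\rho$ is almost surely finite, $(U,\rho)$ is said to have nonexplosive growth, and $\iota(U,\rho)$ is defined as the probability that $\rho$ belongs to the greedy independent set of the induced subgraph $U[\mathcal P_\rho]$ whose vertices are inspected in increasing order of their labels. Let $\lambda\in(0,\infty)$. (a) Let $\mathcal T_\lambda$ be the Galton–Watson tree with offspring distribution Poisson$(\lambda)$, rooted at its initial vertex. Then $\mathcal T_\lambda$ has nonexplosive growth and $$\iota(\mathcal T_\lambda)=\frac{\ln(1+\lambda)}{\lambda}.$$ (b) Let $G(n,\lambda/n)$ be the binomial random graph on $n$ vertices (each pair of vertices is joined independently with probability $\lambda/n$,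 where $n\ge\lambda$), and let the random order used by the greedy algorithm be independent of the graph. Then $\iota(G(n,\lambda/n))\sim\ln(1+\lambda)/\lambda$ with high probability; that is, for every $\varepsilon>0$, $$\Pr\left[\left|\iota(G(n,\lambda/n))-\frac{\ln(1+\lambda)}{\lambda}\right|\le\varepsilon\,\frac{\ln(1+\lambda)}{\lambda}\right]\longrightarrow 1\qquad(n\to\infty).$$ -/

import Mathlib

open MeasureTheory ProbabilityTheory Filter Topology
open scoped NNReal

noncomputable section

/-! ### The greedy maximal independent set -/

open Classical in
/-- The greedy algorithm: the vertices in the list `l` are inspected one by one in order, and the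
current vertex is added to the set built so far if it is not adjacent to any vertex added before.
Only adjacencies between vertices of `l` are used, so if `l` lists a vertex set `S` then this is the
greedy maximal independent set of the induced subgraph `G[S]` with respect to the order of `l`. -/
def greedyMIS {V : Type*} (G : SimpleGraph V) (l : List V) : Set V :=
  l.foldl (fun I v => if ∀ u ∈ I, ¬ G.Adj u v then insert v I else I) ∅

/-- The density `|I(G)| / n` of the greedy maximal independent set of a graph `G` on `n` vertices,
when the vertices are inspected in the order `π 0, π 1, …, π (n - 1)`. -/
def greedyDensity {n : ℕ} (G : SimpleGraph (Fin n)) (π : Equiv.Perm (Fin n)) : ℝ :=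
  ((greedyMIS G (List.ofFn π)).ncard : ℝ) / n

/-! ### Random rooted graphs

A random rooted graph is given by a law `μ` on the simple graphs on a fixed countable vertex type
`V` and a root `ρ : V`; what matters is the connected component of `ρ`. -/

/-- The law of a random labelling: independent labels, uniform on `[0, 1]`. -/
def labelLaw (V : Type*) : Measure (V → unitInterval) :=
  Measure.infinitePi fun _ : V => (volume : Measure unitInterval)

instance (V : Type*) : IsProbabilityMeasure (labelLaw V) := by
  unfold labelLaw; infer_instance

/-- The past of `v`: the vertices reachable from `v` by a path along which labels decrease. -/
def past {V : Type*} (G : SimpleGraph V) (s : V → unitInterval) (v : V) : Set V :=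
  {w | Relation.ReflTransGen (fun a b => G.Adj a b ∧ s b < s a) v w}

/-- Nonexplosive growth: the past of the root is almost surely finite. -/
def NonexplosiveGrowth {V : Type*} (μ : Measure (SimpleGraph V)) (ρ : V) : Prop :=
  ∀ᵐ p ∂(μ.prod (labelLaw V)), (past p.1 p.2 ρ).Finite

/-- The root belongs to the greedy maximal independent set of the subgraph induced by its past:
`l` lists the past of `ρ` in the order of increasing labels (so the past is finite). -/
def RootOccupied {V : Type*} (G : SimpleGraph V) (s : V → unitInterval) (ρ : V) : Prop :=
  ∃ l : List V, {v | v ∈ l} = past G s ρ ∧ l.Pairwise (fun a b => s a < s b) ∧ ρ ∈ greedyMIS G l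

/-- `ι(U, ρ)`: the probability that the root is in the greedy maximal independent set of its past. -/
def rootDensity {V : Type*} (μ : Measure (SimpleGraph V)) (ρ : V) : ℝ :=
  (μ.prod (labelLaw V)).real {p | RootOccupied p.1 p.2 ρ}

/-! ### The Poisson Galton–Watson tree -/

/-- The vertices of the family tree in which the vertex `v` has `c v` children
`v ++ [0], …, v ++ [c v - 1]`; the root is the empty sequence. -/
inductive IsTreeVertex (c : List ℕ → ℕ) : List ℕ → Prop
  | root : IsTreeVertex c []
  | child {v : List ℕ} {i : ℕ} : IsTreeVertex c v → i < c v → IsTreeVertex c (v ++ [i])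

/-- The family tree as a graph: every tree vertex is joined to its children. (Sequences that are not
tree vertices are isolated points, so the tree is the connected component of the root.) -/
def familyTree (c : List ℕ → ℕ) : SimpleGraph (List ℕ) :=
  SimpleGraph.fromRel fun u w => IsTreeVertex c u ∧ ∃ i, i < c u ∧ w = u ++ [i]

/-- The law of the Galton–Watson tree with offspring distribution Poisson(`r`): the numbers of
children are independent Poisson(`r`) variables. The root is `[]`. -/
def poissonGW (r : ℝ≥0) : Measure (SimpleGraph (List ℕ)) :=
  (Measure.infinitePi fun _ : List ℕ => poissonMeasure r).map familyTree

lemma measurableSet_isTreeVertex (v : List ℕ) :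
    MeasurableSet {c : List ℕ → ℕ | IsTreeVertex c v} := by
  induction v using List.reverseRecOn with
  | nil => simp [IsTreeVertex.root]
  | append_singleton v i ih =>
    have h : {c : List ℕ → ℕ | IsTreeVertex c (v ++ [i])}
        = {c | IsTreeVertex c v} ∩ {c | i < c v} := by
      ext c
      constructor
      · intro h
        generalize hw : v ++ [i] = w at h
        cases h with
        | root => simp at hw
        | child h1 h2 =>
          obtain ⟨rfl, h3⟩ := List.append_inj' hw rfl
          obtain rfl : i = _ := by simpa using h3
          exact ⟨h1, h2⟩
      · rintro ⟨h1, h2⟩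
        exact .child h1 h2
    rw [h]
    exact ih.inter (measurableSet_lt measurable_const (measurable_pi_apply v))

/-- The family tree is a measurable function of the numbers of children, so `poissonGW r` is
a genuine image measure. -/
lemma measurable_familyTree : Measurable familyTree := by
  have key : ∀ u w : List ℕ,
      Measurable fun c : List ℕ → ℕ => IsTreeVertex c u ∧ ∃ i, i < c u ∧ w = u ++ [i] := by
    intro u w
    refine .and (measurableSet_setOfPred.1 (measurableSet_isTreeVertex u)) (.exists fun i => ?_)
    exact .and (measurableSet_setOfPred.1
      (measurableSet_lt measurable_const (measurable_pi_apply u))) measurable_const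
  rw [SimpleGraph.measurable_iff_adj]
  intro u w
  simp only [familyTree, SimpleGraph.fromRel_adj]
  exact .and measurable_const (.or (key u w) (key w u))

instance (r : ℝ≥0) : IsProbabilityMeasure (poissonGW r) :=
  Measure.isProbabilityMeasure_map measurable_familyTree.aemeasurable

/-! ### Binomial random graphs -/

instance (n : ℕ) : MeasurableSpace (Equiv.Perm (Fin n)) := ⊤

/-- The joint law of the binomial random graph `G(n, r / n)` and of an independent uniformly random
order of its vertices. (For `r > n` the edge probability is cut off at `1`.) -/
def binomialGraphOrderLaw (r : ℝ≥0) (n : ℕ) :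
    Measure (SimpleGraph (Fin n) × Equiv.Perm (Fin n)) :=
  (SimpleGraph.binomialRandom (Fin n) (Set.projIcc (0 : ℝ) 1 zero_le_one ((r : ℝ) / n))).prod
    (PMF.uniformOfFintype (Equiv.Perm (Fin n))).toMeasure

/-- `X n ∼ a` with high probability: for every `ε > 0`, the probability that `X n` lies within
a factor `1 ± ε` of `a` tends to `1`. -/
def AsympWHP {Ω : ℕ → Type*} [∀ n, MeasurableSpace (Ω n)] (P : ∀ n, Measure (Ω n))
    (X : ∀ n, Ω n → ℝ) (a : ℝ) : Prop :=
  ∀ ε : ℝ, 0 < ε → Tendsto (fun n => (P n).real {ω | |X n ω - a| ≤ ε * |a|}) atTop (𝓝 1)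

end

/-!
Finite graphs. Inspect the vertices in a fixed order and let `q = 1 - p`. Each vertex is accepted
with conditional probability `q ^ i`, where `i` is the current size of the independent set, so each
inspection raises the mean of `q⁻¹ ^ i` by exactly `q⁻¹ - 1`. Hence `q⁻¹ ^ |I|` has mean
`1 + n (q⁻¹ - 1) → 1 + r`; the same computation for the second moment gives a variance that tends
to zero. Taking logarithms, `|I| / n → log (1 + r) / r` in probability, whatever the order.

Trees. Let `f t` be the probability that the root is occupied and has label less than `t`. The root
is occupied if and only if no child with a smaller label is occupied in its own subtree, and the
subtrees are independent copies of the tree, so `f' = G (1 - f)`, where `G` is the generating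
function of the offspring distribution; in the Poisson case `f' = exp (-r f)` and
`f 1 = log (1 + r) / r`. In the same way the probability `y t` that the past of the root is infinite
and the root has label less than `t` satisfies `y' = 1 - G (1 - y) ≤ m y`, where `m` is the mean
number of children, so `y = 0` by Grönwall's inequality.
-/

noncomputable section

/-! ### The greedy algorithm -/

section Greedy

variable {V W : Type*}

lemma greedyMIS_nil (G : SimpleGraph V) : greedyMIS G [] = ∅ := rfl

open Classical in
lemma greedyMIS_append_singleton (G : SimpleGraph V) (l : List V) (v : V) :
    greedyMIS G (l ++ [v]) =
      if ∀ u ∈ greedyMIS G l, ¬ G.Adj u v then insert v (greedyMIS G l) else greedyMIS G l := by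
  simp only [greedyMIS, List.foldl_append, List.foldl_cons, List.foldl_nil]
  congr

lemma mem_greedyMIS_append_singleton {G : SimpleGraph V} {l : List V} {v w : V} :
    w ∈ greedyMIS G (l ++ [v]) ↔
      w ∈ greedyMIS G l ∨ w = v ∧ ∀ u ∈ greedyMIS G l, ¬ G.Adj u v := by
  rw [greedyMIS_append_singleton]
  split_ifs with h
  · rw [Set.mem_insert_iff, or_comm, and_iff_left h]
  · simp only [h, and_false, or_false]

lemma greedyMIS_subset (G : SimpleGraph V) (l : List V) : greedyMIS G l ⊆ {v | v ∈ l} := by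
  induction l using List.reverseRecOn with
  | nil => simp [greedyMIS_nil]
  | append_singleton l a ih =>
    intro v hv
    rcases mem_greedyMIS_append_singleton.1 hv with h | ⟨rfl, -⟩
    · exact List.mem_append_left _ (ih h)
    · simp

lemma finite_greedyMIS (G : SimpleGraph V) (l : List V) : (greedyMIS G l).Finite :=
  l.finite_toSet.subset (greedyMIS_subset G l)

lemma greedyMIS_congr {G H : SimpleGraph V} {l : List V}
    (h : ∀ u ∈ l, ∀ v ∈ l, (G.Adj u v ↔ H.Adj u v)) : greedyMIS G l = greedyMIS H l := by
  induction l using List.reverseRecOn with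
  | nil => rfl
  | append_singleton l a ih =>
    have ih' := ih fun u hu v hv => h u (by simp [hu]) v (by simp [hv])
    ext w
    rw [mem_greedyMIS_append_singleton, mem_greedyMIS_append_singleton, ih']
    refine or_congr Iff.rfl (and_congr Iff.rfl (forall₂_congr fun u hu => ?_))
    rw [h u (List.mem_append_left _ (greedyMIS_subset H l hu)) a (by simp)]

lemma greedyMIS_map {G : SimpleGraph V} {H : SimpleGraph W} (f : G ↪g H) (l : List V) :
    greedyMIS H (l.map f) = f '' greedyMIS G l := by
  induction l using List.reverseRecOn with
  | nil => simp [greedyMIS_nil]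
  | append_singleton l a ih =>
    rw [List.map_append, List.map_singleton, greedyMIS_append_singleton,
      greedyMIS_append_singleton, ih]
    have hadj : (∀ u ∈ f '' greedyMIS G l, ¬ H.Adj u (f a)) ↔ ∀ u ∈ greedyMIS G l, ¬ G.Adj u a := by
      simp only [Set.forall_mem_image, f.map_adj_iff]
    by_cases h : ∀ u ∈ greedyMIS G l, ¬ G.Adj u a
    · rw [if_pos (hadj.2 h), if_pos h, Set.image_insert_eq]
    · rw [if_neg (hadj.not.2 h), if_neg h]

end Greedy

/-! ### Edges of the binomial random graph -/

section BinomialEdges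

open unitInterval
open SimpleGraph (binomialRandom)

variable {V : Type*} [Countable V]

lemma map_edgeSet_binomialRandom (p : I) :
    (binomialRandom V p).map (fun G e => e ∈ G.edgeSet) = Measure.infinitePi fun e : Sym2 V =>
      toNNReal p • Measure.dirac (¬ e.IsDiag) + toNNReal (σ p) • Measure.dirac False := by
  have hset : Measurable fun x : Sym2 V → Prop => {e | x e} :=
    MeasurableEquiv.setOfPred.measurable
  have hcomp : ((fun G : SimpleGraph V => fun e => e ∈ G.edgeSet) ∘ SimpleGraph.fromEdgeSet) ∘
      (fun x : Sym2 V → Prop => {e | x e}) = fun x e => x e ∧ ¬ e.IsDiag := by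
    ext x e
    simp
  rw [SimpleGraph.binomialRandom_eq_map, setBernoulli_eq_map,
    Measure.map_map (by fun_prop) (by fun_prop), Measure.map_map (by fun_prop) hset, hcomp,
    Measure.infinitePi_map_pi _ (f := fun (e : Sym2 V) q => q ∧ ¬ e.IsDiag)
      fun _ => .of_discrete]
  congr! 2 with e
  rw [Measure.map_add _ _ .of_discrete, Measure.map_smul, Measure.map_smul,
    Measure.map_dirac' .of_discrete, Measure.map_dirac' .of_discrete]
  simp

lemma map_mem_edgeSet_binomialRandom (p : I) (e : Sym2 V) :
    (binomialRandom V p).map (fun G => e ∈ G.edgeSet) =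
      toNNReal p • Measure.dirac (¬ e.IsDiag) + toNNReal (σ p) • Measure.dirac False := by
  rw [← Measure.infinitePi_map_eval (fun e : Sym2 V => toNNReal p • Measure.dirac (¬ e.IsDiag) +
    toNNReal (σ p) • Measure.dirac False) e, ← map_edgeSet_binomialRandom,
    Measure.map_map (measurable_pi_apply e) (by fun_prop)]
  rfl

lemma iIndepFun_mem_edgeSet_binomialRandom (p : I) :
    iIndepFun (fun (e : Sym2 V) (G : SimpleGraph V) => e ∈ G.edgeSet) (binomialRandom V p) := by
  rw [iIndepFun_iff_map_fun_eq_infinitePi_map fun e => by fun_prop, map_edgeSet_binomialRandom]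
  simp only [map_mem_edgeSet_binomialRandom]

lemma binomialRandom_not_adj (p : I) {u v : V} (huv : u ≠ v) :
    binomialRandom V p {G | ¬ G.Adj u v} = toNNReal (σ p) := by
  have hset : {G : SimpleGraph V | ¬ G.Adj u v} = (fun G => s(u, v) ∈ G.edgeSet) ⁻¹' {False} := by
    ext G
    simp
  rw [hset, ← Measure.map_apply (by fun_prop) .of_discrete, map_mem_edgeSet_binomialRandom]
  simp [huv]

lemma binomialRandom_forall_not_adj (p : I) {S : Finset V} {v : V} (hv : v ∉ S) :
    binomialRandom V p {G | ∀ u ∈ S, ¬ G.Adj u v} = toNNReal (σ p) ^ S.card := by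
  classical
  have hinj : Set.InjOn (fun u => s(u, v)) (S : Set V) := fun a _ b _ hab => Sym2.congr_left.1 hab
  have hset : {G : SimpleGraph V | ∀ u ∈ S, ¬ G.Adj u v} =
      ⋂ e ∈ S.image fun u => s(u, v), (fun G : SimpleGraph V => e ∈ G.edgeSet) ⁻¹' {False} := by
    ext G
    simp
  rw [hset, (iIndepFun_mem_edgeSet_binomialRandom p).measure_inter_preimage_eq_mul _
    fun _ _ => .of_discrete, Finset.prod_image hinj]
  refine Finset.prod_eq_pow_card fun u hu => ?_
  rw [← binomialRandom_not_adj p (ne_of_mem_of_not_mem hu hv)]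
  congr 1
  ext G
  simp

lemma binomialRandom_inter_forall_not_adj (p : I) {S T : Finset V} {v : V} (hS : v ∉ S)
    (hT : v ∉ T) {A : Set (SimpleGraph V)}
    (hA : ∀ G H : SimpleGraph V, (∀ u ∈ T, ∀ w ∈ T, G.Adj u w ↔ H.Adj u w) → (G ∈ A ↔ H ∈ A)) :
    binomialRandom V p (A ∩ {G | ∀ u ∈ S, ¬ G.Adj u v}) =
      binomialRandom V p A * toNNReal (σ p) ^ S.card := by
  classical
  let E : Finset (Sym2 V) := S.image fun u => s(u, v)
  have hdisj : Disjoint T.sym2 E := by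
    simp only [Finset.disjoint_left, E, Finset.mem_image, not_exists, not_and]
    rintro e he u - rfl
    exact hT (Finset.mk_mem_sym2_iff.1 he).2
  have hpreim {F : Finset (Sym2 V)} {B : Set (SimpleGraph V)}
      (hB : ∀ G H : SimpleGraph V, (∀ e ∈ F, e ∈ G.edgeSet ↔ e ∈ H.edgeSet) → G ∈ B → H ∈ B) :
      (fun G (e : F) => e.1 ∈ G.edgeSet) ⁻¹' ((fun G (e : F) => e.1 ∈ G.edgeSet) '' B) = B :=
    (Set.subset_preimage_image _ _).antisymm' fun H ⟨G, hG, h⟩ =>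
      hB G H (fun e he => iff_of_eq (congrFun h ⟨e, he⟩)) hG
  have hAE := hpreim (F := T.sym2) (B := A) fun G H h => (hA G H fun u hu w hw =>
    h s(u, w) (Finset.mk_mem_sym2_iff.2 ⟨hu, hw⟩)).1
  have hvE := hpreim (F := E) (B := {G | ∀ u ∈ S, ¬ G.Adj u v}) fun G H h hG u hu hadj =>
    hG u hu ((h s(u, v) (Finset.mem_image_of_mem _ hu)).2 hadj)
  rw [← binomialRandom_forall_not_adj p hS, ← hAE, ← hvE]
  exact ((iIndepFun_mem_edgeSet_binomialRandom p).indepFun_finset _ _ hdisj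
    fun e => by fun_prop).measure_inter_preimage_eq_mul _ _ .of_discrete .of_discrete

end BinomialEdges

section GreedyMoments

open unitInterval
open SimpleGraph (binomialRandom)

variable {V : Type*}

instance [Countable V] : MeasurableSingletonClass (SimpleGraph V) where
  measurableSet_singleton G := by
    have h : ({G} : Set (SimpleGraph V)) = ⋂ u, ⋂ v, {H | H.Adj u v ↔ G.Adj u v} := by
      ext H
      simp [SimpleGraph.ext_iff, funext_iff]
    rw [h]
    refine .iInter fun u => .iInter fun v => measurableSet_setOfPred.2 ?_
    exact .iff (by fun_prop) measurable_const

/- Inspecting the vertices of `l` reveals no edge at `v`, so every edge between `v` and the greedy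
set of `l` is still absent with probability `1 - p`. -/
lemma binomialRandom_real_greedyMIS_inter [Countable V] (p : I) {l : List V} {v : V} (hv : v ∉ l)
    (S : Set V) :
    (binomialRandom V p).real
        ((greedyMIS · l) ⁻¹' {S} ∩ {G | ∀ u ∈ greedyMIS G l, ¬ G.Adj u v}) =
      (binomialRandom V p).real ((greedyMIS · l) ⁻¹' {S}) * (1 - p) ^ S.ncard := by
  classical
  by_cases hS : S ⊆ {w | w ∈ l}
  · obtain ⟨S, rfl⟩ := (l.finite_toSet.subset hS).exists_finset_coe
    have hinter : (greedyMIS · l) ⁻¹' {↑S} ∩ {G | ∀ u ∈ greedyMIS G l, ¬ G.Adj u v} =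
        (greedyMIS · l) ⁻¹' {↑S} ∩ {G | ∀ u ∈ S, ¬ G.Adj u v} := by
      ext G
      simp +contextual
    have hdet (G H : SimpleGraph V)
        (h : ∀ u ∈ l.toFinset, ∀ w ∈ l.toFinset, G.Adj u w ↔ H.Adj u w) :
        G ∈ (greedyMIS · l) ⁻¹' {↑S} ↔ H ∈ (greedyMIS · l) ⁻¹' {↑S} := by
      simp only [Set.mem_preimage, greedyMIS_congr (by simpa using h)]
    simp [hinter, measureReal_def, binomialRandom_inter_forall_not_adj p (fun h => hv (hS h))
      (by simpa using hv) hdet]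
  · have hempty : (greedyMIS · l) ⁻¹' {S} = ∅ :=
      Set.eq_empty_of_forall_notMem fun G hG => hS (hG ▸ greedyMIS_subset G l)
    simp [hempty]

variable [Finite V]

lemma setIntegral_greedyMIS (p : I) {l : List V} {v : V} (hv : v ∉ l) (F : Set V → ℝ) :
    ∫ G in {G | ∀ u ∈ greedyMIS G l, ¬ G.Adj u v}, F (greedyMIS G l) ∂binomialRandom V p =
      ∫ G, (1 - p : ℝ) ^ (greedyMIS G l).ncard * F (greedyMIS G l) ∂binomialRandom V p := by
  have := Fintype.ofFinite (Set V)
  have hX : Measurable fun G : SimpleGraph V => greedyMIS G l := .of_discrete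
  rw [← integral_map hX.aemeasurable (f := F) .of_discrete,
    ← integral_map hX.aemeasurable (f := fun S => (1 - p : ℝ) ^ S.ncard * F S) .of_discrete,
    integral_fintype .of_finite, integral_fintype .of_finite]
  refine Finset.sum_congr rfl fun S _ => ?_
  rw [map_measureReal_apply hX .of_discrete, map_measureReal_apply hX .of_discrete,
    measureReal_restrict_apply .of_discrete, binomialRandom_real_greedyMIS_inter p hv, smul_eq_mul,
    smul_eq_mul, mul_assoc]

lemma integral_greedyMIS_append_singleton (p : I) {l : List V} {v : V} (hv : v ∉ l) (F : ℕ → ℝ) :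
    ∫ G, F (greedyMIS G (l ++ [v])).ncard ∂binomialRandom V p =
      ∫ G, F (greedyMIS G l).ncard ∂binomialRandom V p +
        ∫ G, (1 - p : ℝ) ^ (greedyMIS G l).ncard *
          (F ((greedyMIS G l).ncard + 1) - F (greedyMIS G l).ncard) ∂binomialRandom V p := by
  classical
  rw [← setIntegral_greedyMIS p hv fun S => F (S.ncard + 1) - F S.ncard,
    ← integral_indicator .of_discrete, ← integral_add .of_finite .of_finite]
  refine integral_congr_ae (.of_forall fun G => ?_)
  have hvG : v ∉ greedyMIS G l := fun h => hv (greedyMIS_subset G l h)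
  simp only [greedyMIS_append_singleton, Set.indicator_apply, Set.mem_ofPred_eq]
  split_ifs
  · rw [Set.ncard_insert_of_notMem hvG (finite_greedyMIS G l), add_sub_cancel]
  · rw [add_zero]

variable {p : I} {a : ℝ}

lemma integral_pow_greedyMIS (ha : a * (1 - p) = 1) {l : List V} (hl : l.Nodup) :
    ∫ G, a ^ (greedyMIS G l).ncard ∂binomialRandom V p = 1 + l.length * (a - 1) := by
  induction l using List.reverseRecOn with
  | nil => simp [greedyMIS_nil]
  | append_singleton l v ih =>
    obtain ⟨hv, hl⟩ := by rwa [List.nodup_append_comm, List.singleton_append, List.nodup_cons] at hl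
    have hstep (k : ℕ) : (1 - p : ℝ) ^ k * (a ^ (k + 1) - a ^ k) = a - 1 := by
      have hk : a ^ k * (1 - p : ℝ) ^ k = 1 := by rw [← mul_pow, ha, one_pow]
      linear_combination (a - 1) * hk
    simp only [integral_greedyMIS_append_singleton p hv, ih hl, hstep, integral_const,
      probReal_univ, one_smul, List.length_append, List.length_singleton, Nat.cast_add,
      Nat.cast_one]
    ring

lemma integral_sq_pow_greedyMIS (ha : a * (1 - p) = 1) {l : List V} (hl : l.Nodup) :
    ∫ G, (a ^ (greedyMIS G l).ncard) ^ 2 ∂binomialRandom V p =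
      1 + (a ^ 2 - 1) * (l.length + (a - 1) * (l.length * (l.length - 1) / 2)) := by
  induction l using List.reverseRecOn with
  | nil => simp [greedyMIS_nil]
  | append_singleton l v ih =>
    obtain ⟨hv, hl⟩ := by rwa [List.nodup_append_comm, List.singleton_append, List.nodup_cons] at hl
    have hstep (k : ℕ) :
        (1 - p : ℝ) ^ k * ((a ^ (k + 1)) ^ 2 - (a ^ k) ^ 2) = (a ^ 2 - 1) * a ^ k := by
      have hk : a ^ k * (1 - p : ℝ) ^ k = 1 := by rw [← mul_pow, ha, one_pow]
      linear_combination (a ^ 2 - 1) * a ^ k * hk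
    simp only [integral_greedyMIS_append_singleton p hv fun k => (a ^ k) ^ 2, ih hl, hstep,
      integral_const_mul, integral_pow_greedyMIS ha hl, List.length_append, List.length_singleton,
      Nat.cast_add, Nat.cast_one]
    ring

lemma variance_pow_greedyMIS (ha : a * (1 - p) = 1) {l : List V} (hl : l.Nodup) :
    Var[fun G => a ^ (greedyMIS G l).ncard; binomialRandom V p] =
      (a - 1) ^ 3 * (l.length * (l.length - 1) / 2) := by
  rw [variance_eq_sub .of_discrete]
  simp only [Pi.pow_apply, integral_pow_greedyMIS ha hl, integral_sq_pow_greedyMIS ha hl]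
  ring

end GreedyMoments

/-! ### Convergence in probability -/

section ConvergenceInProbability

variable {ι : Type*} {l : Filter ι} {Ω : ι → Type*} [∀ i, MeasurableSpace (Ω i)]
  {P : ∀ i, Measure (Ω i)}

/-- Convergence in probability of `X i` to the constant `a`, where, unlike in `TendstoInMeasure`,
each `X i` may live on its own probability space. -/
def TendstoInProb {E : Type*} [TopologicalSpace E] (l : Filter ι) (P : ∀ i, Measure (Ω i))
    (X : ∀ i, Ω i → E) (a : E) : Prop :=
  ∀ U ∈ 𝓝 a, Tendsto (fun i => (P i).real (X i ⁻¹' U)) l (𝓝 1)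

variable {E F : Type*} [TopologicalSpace E] [TopologicalSpace F]

lemma TendstoInProb.congr' {X Y : ∀ i, Ω i → E} {a : E} (hX : TendstoInProb l P X a)
    (hXY : ∀ᶠ i in l, X i = Y i) : TendstoInProb l P Y a := fun U hU =>
  (hX U hU).congr' (hXY.mono fun i hi => by simp only [hi])

variable [∀ i, IsProbabilityMeasure (P i)]

lemma TendstoInProb.map_of_tendsto {X : ∀ i, Ω i → E} {a : E} (hX : TendstoInProb l P X a)
    {φ : ι → E → F} {b : F} (hφ : Tendsto (fun q : ι × E => φ q.1 q.2) (l ×ˢ 𝓝 a) (𝓝 b)) :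
    TendstoInProb l P (fun i ω => φ i (X i ω)) b := by
  intro U hU
  obtain ⟨pi, hpi, pa, hpa, hmem⟩ := eventually_prod_iff.1 (hφ.eventually_mem hU)
  refine tendsto_of_tendsto_of_tendsto_of_le_of_le' (hX _ hpa) tendsto_const_nhds ?_
    (.of_forall fun i => measureReal_le_one)
  filter_upwards [hpi] with i hi
  exact measureReal_mono fun ω hω => hmem hi hω

lemma tendstoInProb_of_tendsto_variance {X : ∀ i, Ω i → ℝ} {a : ℝ} (hX : ∀ i, MemLp (X i) 2 (P i))
    (hmean : Tendsto (fun i => ∫ ω, X i ω ∂P i) l (𝓝 a))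
    (hvar : Tendsto (fun i => Var[X i; P i]) l (𝓝 0)) : TendstoInProb l P X a := by
  intro U hU
  obtain ⟨ε, hε, hball⟩ := Metric.mem_nhds_iff.1 hU
  have hlim : Tendsto (fun i => 1 - Var[X i; P i] / (ε / 2) ^ 2) l (𝓝 1) := by
    simpa using (hvar.div_const ((ε / 2) ^ 2)).const_sub 1
  refine tendsto_of_tendsto_of_tendsto_of_le_of_le' hlim tendsto_const_nhds ?_
    (.of_forall fun i => measureReal_le_one)
  filter_upwards [Metric.tendsto_nhds.1 hmean (ε / 2) (half_pos hε)] with i hi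
  have hcheb : (P i).real {ω | ε / 2 ≤ |X i ω - ∫ ω, X i ω ∂P i|} ≤ Var[X i; P i] / (ε / 2) ^ 2 :=
    ENNReal.toReal_le_of_le_ofReal (div_nonneg (variance_nonneg _ _) (sq_nonneg _))
      (meas_ge_le_variance_div_sq (hX i) (half_pos hε))
  have hcover : Set.univ ⊆ X i ⁻¹' U ∪ {ω | ε / 2 ≤ |X i ω - ∫ ω, X i ω ∂P i|} := fun ω _ => by
    rw [Set.mem_union, or_iff_not_imp_right, Set.mem_ofPred_eq, not_le, ← Real.dist_eq]
    intro hω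
    exact hball ((dist_triangle _ _ _).trans_lt (by linarith))
  have hone := (measureReal_mono (μ := P i) hcover).trans (measureReal_union_le _ _)
  rw [probReal_univ] at hone
  linarith

end ConvergenceInProbability

lemma TendstoInProb.asympWHP {Ω : ℕ → Type*} [∀ n, MeasurableSpace (Ω n)] {P : ∀ n, Measure (Ω n)}
    {X : ∀ n, Ω n → ℝ} {a : ℝ} (hX : TendstoInProb atTop P X a) (ha : a ≠ 0) : AsympWHP P X a :=
  fun ε hε => by
    simpa only [Set.preimage, Metric.mem_closedBall, Real.dist_eq] using
      hX _ (Metric.closedBall_mem_nhds a (mul_pos hε (abs_pos.2 ha)))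

/-! ### The greedy density of the binomial random graph -/

section GreedyDensity

open unitInterval
open SimpleGraph (binomialRandom)

lemma integral_prod_eq_of_forall_integral_eq {α β : Type*} [MeasurableSpace α] [MeasurableSpace β]
    {μ : Measure α} [SFinite μ] {ν : Measure β} [IsProbabilityMeasure ν] {f : α × β → ℝ} {c : ℝ}
    (hf : Integrable f (μ.prod ν)) (hc : ∀ y, ∫ x, f (x, y) ∂μ = c) :
    ∫ z, f z ∂μ.prod ν = c := by
  simp [integral_prod_symm _ hf, hc]

variable {n : ℕ} {p : I} {a : ℝ} (Q : Measure (Equiv.Perm (Fin n))) [IsProbabilityMeasure Q]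

lemma integral_pow_greedyMIS_ofFn (ha : a * (1 - p) = 1) :
    ∫ x, a ^ (greedyMIS x.1 (List.ofFn x.2)).ncard ∂(binomialRandom (Fin n) p).prod Q =
      1 + n * (a - 1) :=
  integral_prod_eq_of_forall_integral_eq .of_finite fun π => by
    rw [integral_pow_greedyMIS ha (List.nodup_ofFn.2 π.injective), List.length_ofFn]

lemma variance_pow_greedyMIS_ofFn (ha : a * (1 - p) = 1) :
    Var[fun x => a ^ (greedyMIS x.1 (List.ofFn x.2)).ncard; (binomialRandom (Fin n) p).prod Q] =
      (a - 1) ^ 3 * (n * (n - 1) / 2) := by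
  rw [variance_eq_integral .of_discrete, integral_pow_greedyMIS_ofFn Q ha]
  refine integral_prod_eq_of_forall_integral_eq .of_finite fun π => ?_
  have hπ := List.nodup_ofFn.2 π.injective
  have h := variance_pow_greedyMIS ha hπ
  rw [variance_eq_integral .of_discrete, integral_pow_greedyMIS ha hπ] at h
  simpa only [List.length_ofFn] using h

variable {p : ℕ → I} {r : ℝ}

lemma tendsto_of_tendsto_nat_mul {u : ℕ → ℝ} (hu : Tendsto (fun n => n * u n) atTop (𝓝 r)) :
    Tendsto u atTop (𝓝 0) := by
  refine (hu.div_atTop tendsto_natCast_atTop_atTop).congr' ?_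
  filter_upwards [eventually_ne_atTop 0] with n hn
  field_simp

lemma tendsto_nat_mul_inv_one_sub_sub_one {u : ℕ → ℝ}
    (hu : Tendsto (fun n => n * u n) atTop (𝓝 r)) :
    Tendsto (fun n => n * ((1 - u n)⁻¹ - 1)) atTop (𝓝 r) := by
  have hu0 := tendsto_of_tendsto_nat_mul hu
  have h := hu.mul ((hu0.const_sub 1).inv₀ (by norm_num))
  rw [sub_zero, inv_one, mul_one] at h
  refine h.congr' ?_
  filter_upwards [hu0.eventually_ne zero_ne_one] with n hn
  have := sub_ne_zero.2 hn.symm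
  field_simp
  ring

variable (Q : ∀ n, Measure (Equiv.Perm (Fin n))) [∀ n, IsProbabilityMeasure (Q n)]

lemma tendstoInProb_pow_greedyMIS (hp : Tendsto (fun n => n * (p n : ℝ)) atTop (𝓝 r)) :
    TendstoInProb atTop (fun n => (binomialRandom (Fin n) (p n)).prod (Q n))
      (fun n x => (1 - p n : ℝ)⁻¹ ^ (greedyMIS x.1 (List.ofFn x.2)).ncard) (1 + r) := by
  have ha : ∀ᶠ n in atTop, (1 - p n : ℝ)⁻¹ * (1 - p n) = 1 := by
    filter_upwards [(tendsto_of_tendsto_nat_mul hp).eventually_ne zero_ne_one] with n hn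
    exact inv_mul_cancel₀ (sub_ne_zero.2 hn.symm)
  have hn := tendsto_nat_mul_inv_one_sub_sub_one hp
  have h0 := tendsto_of_tendsto_nat_mul hn
  have hvar := (h0.mul (hn.mul (hn.sub h0))).div_const 2
  simp only [zero_mul, zero_div] at hvar
  refine tendstoInProb_of_tendsto_variance (fun _ => .of_discrete)
    ((hn.const_add 1).congr' ?_) (hvar.congr' ?_)
  · filter_upwards [ha] with n hn
    exact (integral_pow_greedyMIS_ofFn (Q n) hn).symm
  · filter_upwards [ha] with n hn
    rw [variance_pow_greedyMIS_ofFn (Q n) hn]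
    ring

theorem tendstoInProb_greedyDensity (hr : 0 < r)
    (hp : Tendsto (fun n => n * (p n : ℝ)) atTop (𝓝 r)) :
    TendstoInProb atTop (fun n => (binomialRandom (Fin n) (p n)).prod (Q n))
      (fun _ x => greedyDensity x.1 x.2) (Real.log (1 + r) / r) := by
  have hlog : Tendsto (fun n => n * Real.log (1 - p n : ℝ)⁻¹) atTop (𝓝 r) := by
    have h := (Real.tendsto_nat_mul_log_one_add_of_tendsto (g := fun n => -p n)
      (by simpa only [mul_neg] using hp.neg)).neg
    simpa only [neg_neg, ← sub_eq_add_neg, ← mul_neg, ← Real.log_inv] using h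
  refine TendstoInProb.congr' ((tendstoInProb_pow_greedyMIS Q hp).map_of_tendsto
    (φ := fun n x => Real.log x / (n * Real.log (1 - p n : ℝ)⁻¹))
    ((tendsto_snd.log (by positivity)).div (hlog.comp tendsto_fst) hr.ne')) ?_
  filter_upwards [hlog.eventually_ne hr.ne'] with n hn
  ext x
  rw [Real.log_pow, mul_div_mul_right _ _ (right_ne_zero_of_mul hn), greedyDensity]

end GreedyDensity

/-! ### Pasts -/

section LabelledGreedy

variable {V α : Type*} [Preorder α] {G : SimpleGraph V} {s : V → α}

lemma mem_greedyMIS_append {l₁ l₂ : List V} {w : V} (hw : w ∉ l₂) :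
    w ∈ greedyMIS G (l₁ ++ l₂) ↔ w ∈ greedyMIS G l₁ := by
  induction l₂ using List.reverseRecOn with
  | nil => rw [List.append_nil]
  | append_singleton l₂ a ih =>
    rw [List.mem_append, not_or, List.mem_singleton] at hw
    rw [← List.append_assoc, mem_greedyMIS_append_singleton, ih hw.1]
    simp only [hw.2, false_and, or_false]

lemma mem_greedyMIS_iff {l : List V} (hl : l.Pairwise fun a b => s a < s b) {w : V} (hw : w ∈ l) :
    w ∈ greedyMIS G l ↔ ∀ u ∈ l, s u < s w → G.Adj u w → u ∉ greedyMIS G l := by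
  obtain ⟨l₁, l₂, rfl⟩ := List.append_of_mem hw
  simp only [List.pairwise_append, List.pairwise_cons, List.mem_cons, forall_eq_or_imp] at hl
  obtain ⟨-, ⟨hw₂, -⟩, h₁⟩ := hl
  have hbefore {u : V} (hu : u ∈ l₁) :
      u ∈ greedyMIS G (l₁ ++ w :: l₂) ↔ u ∈ greedyMIS G l₁ := by
    refine mem_greedyMIS_append fun hmem => ?_
    rcases List.mem_cons.1 hmem with rfl | hmem
    · exact lt_irrefl _ (h₁ u hu).1
    · exact lt_irrefl _ ((h₁ u hu).2 u hmem)
  have hw₁ : w ∉ greedyMIS G l₁ := fun h => lt_irrefl _ (h₁ w (greedyMIS_subset G l₁ h)).1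
  rw [List.append_cons, mem_greedyMIS_append fun h => lt_irrefl _ (hw₂ w h),
    mem_greedyMIS_append_singleton, or_iff_right hw₁, and_iff_right rfl, ← List.append_cons]
  constructor
  · intro h u hu hlt hadj
    rcases List.mem_append.1 hu with hu₁ | hu₂
    · exact fun hmem => h u ((hbefore hu₁).1 hmem) hadj
    · rcases List.mem_cons.1 hu₂ with rfl | hu₂
      · exact absurd hlt (lt_irrefl _)
      · exact absurd hlt (hw₂ u hu₂).asymm
  · intro h u hu hadj
    have hu₁ := greedyMIS_subset G l₁ hu
    exact h u (List.mem_append_left _ hu₁) (h₁ u hu₁).1 hadj ((hbefore hu₁).2 hu)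

lemma mem_greedyMIS_iff_of_subset {l l' : List V} (hl : l.Pairwise fun a b => s a < s b)
    (hl' : l'.Pairwise fun a b => s a < s b) (hsub : l' ⊆ l)
    (hclosed : ∀ w ∈ l', ∀ u ∈ l, s u < s w → G.Adj u w → u ∈ l') {w : V} (hw : w ∈ l') :
    w ∈ greedyMIS G l' ↔ w ∈ greedyMIS G l := by
  have : IsStrictOrder V fun a b => s a < s b :=
    { irrefl := fun _ => lt_irrefl _
      trans := fun _ _ _ => lt_trans }
  have hwf : Set.WellFoundedOn {w | w ∈ l'} fun a b => s a < s b :=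
    (List.finite_toSet l').wellFoundedOn
  refine hwf.induction (P := fun w => w ∈ greedyMIS G l' ↔ w ∈ greedyMIS G l) hw
    fun w hw ih => ?_
  rw [mem_greedyMIS_iff hl' hw, mem_greedyMIS_iff hl (hsub hw)]
  constructor
  · intro h u hu hlt hadj
    have hu' := hclosed w hw u hu hlt hadj
    rw [← ih u hu' hlt]
    exact h u hu' hlt hadj
  · intro h u hu hlt hadj
    rw [ih u hu hlt]
    exact h u (hsub hu) hlt hadj

end LabelledGreedy

section Past

variable {V : Type*} {G : SimpleGraph V}

lemma self_mem_past (s : V → unitInterval) (v : V) : v ∈ past G s v := Relation.ReflTransGen.refl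

variable {s : V → unitInterval}

lemma past_trans {u v w : V} (h : v ∈ past G s u) (h' : w ∈ past G s v) : w ∈ past G s u :=
  Relation.ReflTransGen.trans h h'

lemma mem_past_of_adj {u v : V} (h : G.Adj v u) (hs : s u < s v) : u ∈ past G s v :=
  Relation.ReflTransGen.single ⟨h, hs⟩

lemma past_eq (v : V) :
    past G s v = insert v (⋃ u ∈ {u | G.Adj v u ∧ s u < s v}, past G s u) := by
  ext w
  simp only [Set.mem_insert_iff, Set.mem_iUnion, Set.mem_ofPred_eq, exists_prop]
  exact Relation.ReflTransGen.cases_head_iff.trans (or_congr_left eq_comm)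

lemma finite_past_iff {v : V} (hv : {u | G.Adj v u}.Finite) :
    (past G s v).Finite ↔ ∀ u, G.Adj v u → s u < s v → (past G s u).Finite := by
  refine ⟨fun h u hadj hlt => h.subset fun w hw => past_trans (mem_past_of_adj hadj hlt) hw,
    fun h => ?_⟩
  rw [past_eq, Set.finite_insert]
  exact (hv.subset fun u hu => hu.1).biUnion fun u hu => h u hu.1 hu.2

lemma exists_pairwise_lt_list (hs : Function.Injective s) {A : Set V} (hA : A.Finite) :
    ∃ l : List V, {v | v ∈ l} = A ∧ l.Pairwise fun a b => s a < s b := by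
  let _ : LinearOrder V := LinearOrder.lift' s hs
  exact ⟨hA.toFinset.sort (· ≤ ·), by ext; simp, (Finset.sortedLT_sort _).pairwise⟩

lemma rootOccupied_iff_mem_greedyMIS {l : List V} {v : V} (hl : l.Pairwise fun a b => s a < s b)
    (hlv : past G s v ⊆ {u | u ∈ l}) : RootOccupied G s v ↔ v ∈ greedyMIS G l := by
  classical
  have hiff {l' : List V} (hmem : {u | u ∈ l'} = past G s v)
      (hl' : l'.Pairwise fun a b => s a < s b) : v ∈ greedyMIS G l' ↔ v ∈ greedyMIS G l := by
    simp only [Set.ext_iff, Set.mem_ofPred_eq] at hmem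
    refine mem_greedyMIS_iff_of_subset hl hl' (fun u hu => hlv ((hmem u).1 hu)) ?_
      ((hmem v).2 (self_mem_past s v))
    intro w hw u _ hlt hadj
    exact (hmem u).2 (past_trans ((hmem w).1 hw) (mem_past_of_adj hadj.symm hlt))
  constructor
  · rintro ⟨l', hmem, hl', hv⟩
    exact (hiff hmem hl').1 hv
  · intro hv
    have hmem : {u | u ∈ l.filter (· ∈ past G s v)} = past G s v := by
      ext u
      simpa using @hlv u
    exact ⟨_, hmem, hl.filter _, (hiff hmem (hl.filter _)).2 hv⟩

lemma rootOccupied_iff (hs : Function.Injective s) {v : V} (hfin : (past G s v).Finite) :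
    RootOccupied G s v ↔ ∀ u, G.Adj v u → s u < s v → ¬ RootOccupied G s u := by
  obtain ⟨l, hmem, hl⟩ := exists_pairwise_lt_list hs hfin
  have hocc {u : V} (hu : u ∈ past G s v) : RootOccupied G s u ↔ u ∈ greedyMIS G l :=
    rootOccupied_iff_mem_greedyMIS hl fun w hw => hmem.ge (past_trans hu hw)
  rw [hocc (self_mem_past s v), mem_greedyMIS_iff hl (hmem.ge (self_mem_past s v))]
  constructor
  · intro h u hadj hlt
    have hu := mem_past_of_adj hadj hlt
    rw [hocc hu]
    exact h u (hmem.ge hu) hlt hadj.symm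
  · intro h u hu hlt hadj
    rw [← hocc (hmem.le hu)]
    exact h u hadj.symm hlt

end Past

section PastEmbedding

variable {V W : Type*} {G : SimpleGraph V} {H : SimpleGraph W} {s : W → unitInterval}
  (f : G ↪g H) (hf : ∀ a w, H.Adj (f a) w → s w < s (f a) → w ∈ Set.range f)

include hf

lemma past_embedding (v : V) : past H s (f v) = f '' past G (s ∘ f) v := by
  refine Set.Subset.antisymm (fun w hw => ?_) (Set.image_subset_iff.2 fun w hw =>
    Relation.ReflTransGen.lift f (fun a b h => ⟨f.map_adj_iff.2 h.1, h.2⟩) _ _ hw)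
  induction hw with
  | refl => exact ⟨v, self_mem_past _ v, rfl⟩
  | tail _ hstep ih =>
    obtain ⟨a, ha, rfl⟩ := ih
    obtain ⟨b, rfl⟩ := hf a _ hstep.1 hstep.2
    exact ⟨b, past_trans ha (mem_past_of_adj (f.map_adj_iff.1 hstep.1) hstep.2), rfl⟩

lemma rootOccupied_embedding (v : V) : RootOccupied H s (f v) ↔ RootOccupied G (s ∘ f) v := by
  have hset (l : List V) : {w | w ∈ l.map f} = f '' {w | w ∈ l} := by
    ext
    simp
  have hlist (l : List V) : ({w | w ∈ l.map f} = past H s (f v) ∧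
      (l.map f).Pairwise (fun a b => s a < s b) ∧ f v ∈ greedyMIS H (l.map f)) ↔
      {w | w ∈ l} = past G (s ∘ f) v ∧ l.Pairwise (fun a b => (s ∘ f) a < (s ∘ f) b) ∧
        v ∈ greedyMIS G l := by
    rw [past_embedding f hf, hset, f.injective.image_injective.eq_iff, List.pairwise_map,
      greedyMIS_map, f.injective.mem_set_image]
    rfl
  constructor
  · rintro ⟨l, hl⟩
    have hrange : l ∈ Set.range (List.map f) := by
      rw [Set.range_list_map]
      intro w hw
      exact Set.image_subset_range _ _ ((past_embedding f hf v).le (hl.1.le hw))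
    obtain ⟨l, rfl⟩ := hrange
    exact ⟨l, (hlist l).1 hl⟩
  · rintro ⟨l, hl⟩
    exact ⟨l.map f, (hlist l).2 hl⟩

end PastEmbedding

/-! ### Pasts in family trees -/

section FamilyTree

variable {c : List ℕ → ℕ}

lemma isTreeVertex_append_singleton {u : List ℕ} {i : ℕ} :
    IsTreeVertex c (u ++ [i]) ↔ IsTreeVertex c u ∧ i < c u := by
  refine ⟨fun h => ?_, fun h => .child h.1 h.2⟩
  generalize hw : u ++ [i] = w at h
  cases h with
  | root => simp at hw
  | child hv hj =>
    obtain ⟨rfl, rfl⟩ := List.append_singleton_inj.1 hw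
    exact ⟨hv, hj⟩

lemma isTreeVertex_cons {i : ℕ} {u : List ℕ} :
    IsTreeVertex c (i :: u) ↔ i < c [] ∧ IsTreeVertex (fun u => c (i :: u)) u := by
  induction u using List.reverseRecOn with
  | nil =>
    rw [← List.nil_append [i], isTreeVertex_append_singleton]
    simp only [IsTreeVertex.root, true_and, and_true]
  | append_singleton u j ih =>
    rw [← List.cons_append, isTreeVertex_append_singleton, isTreeVertex_append_singleton, ih,
      and_assoc]

lemma familyTree_adj {u w : List ℕ} : (familyTree c).Adj u w ↔
    ∃ i, (w = u ++ [i] ∧ IsTreeVertex c w) ∨ (u = w ++ [i] ∧ IsTreeVertex c u) := by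
  have hchild (u w : List ℕ) : (IsTreeVertex c u ∧ ∃ i, i < c u ∧ w = u ++ [i]) ↔
      ∃ i, w = u ++ [i] ∧ IsTreeVertex c w := by
    rw [← exists_and_left]
    refine exists_congr fun i => ?_
    constructor
    · rintro ⟨hu, hi, rfl⟩
      exact ⟨rfl, .child hu hi⟩
    · rintro ⟨rfl, h⟩
      obtain ⟨hu, hi⟩ := isTreeVertex_append_singleton.1 h
      exact ⟨hu, hi, rfl⟩
  rw [familyTree, SimpleGraph.fromRel_adj, hchild, hchild, ← exists_or, and_iff_right_iff_imp]
  rintro ⟨i, ⟨h, -⟩ | ⟨h, -⟩⟩ rfl <;> simp at h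

lemma familyTree_adj_nil {w : List ℕ} : (familyTree c).Adj [] w ↔ ∃ i < c [], w = [i] := by
  rw [familyTree_adj]
  refine exists_congr fun i => ?_
  constructor
  · rintro (⟨rfl, h⟩ | ⟨h, -⟩)
    · exact ⟨(isTreeVertex_append_singleton.1 h).2, rfl⟩
    · simp at h
  · rintro ⟨hi, rfl⟩
    exact Or.inl ⟨rfl, .child .root hi⟩

lemma familyTree_adj_cons {i : ℕ} (hi : i < c []) {u w : List ℕ} :
    (familyTree c).Adj (i :: u) (i :: w) ↔ (familyTree fun u => c (i :: u)).Adj u w := by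
  simp only [familyTree_adj, isTreeVertex_cons, hi, true_and, List.cons_append, List.cons_inj_right]

/-- The inclusion of the family tree of the `i`-th child of the root into the whole family tree. -/
def childEmbedding {i : ℕ} (hi : i < c []) :
    familyTree (fun u => c (i :: u)) ↪g familyTree c where
  toFun u := i :: u
  inj' _ _ h := List.tail_eq_of_cons_eq h
  map_rel_iff' := familyTree_adj_cons hi

lemma mem_range_childEmbedding {s : List ℕ → unitInterval} {i : ℕ} (hi : i < c [])
    (hs : s [i] < s []) (u w : List ℕ) (hadj : (familyTree c).Adj (childEmbedding hi u) w)
    (hlt : s w < s (childEmbedding hi u)) : w ∈ Set.range (childEmbedding hi) := by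
  obtain ⟨j, ⟨rfl, -⟩ | ⟨hw, -⟩⟩ := familyTree_adj.1 hadj
  · exact ⟨u ++ [j], rfl⟩
  · cases w with
    | nil =>
      rw [hw] at hlt
      obtain ⟨rfl, -⟩ := List.cons_eq_cons.1 hw
      exact absurd hlt hs.asymm
    | cons k w =>
      obtain ⟨rfl, -⟩ := List.cons_eq_cons.1 hw
      exact ⟨w, rfl⟩

lemma finite_past_familyTree_iff {s : List ℕ → unitInterval} :
    (past (familyTree c) s []).Finite ↔ ∀ i < c [], s [i] < s [] →
      (past (familyTree fun u => c (i :: u)) (fun u => s (i :: u)) []).Finite := by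
  have hfin : {u | (familyTree c).Adj [] u}.Finite := by
    refine ((Set.finite_lt_nat (c [])).image fun i => [i]).subset fun u hu => ?_
    obtain ⟨i, hi, rfl⟩ := familyTree_adj_nil.1 hu
    exact ⟨i, hi, rfl⟩
  have hchild (i : ℕ) (hi : i < c []) (hs : s [i] < s []) : (past (familyTree c) s [i]).Finite ↔
      (past (familyTree fun u => c (i :: u)) (fun u => s (i :: u)) []).Finite := by
    have h := past_embedding (childEmbedding hi) (mem_range_childEmbedding hi hs) []
    exact (congrArg Set.Finite h).to_iff.trans
      (Set.finite_image_iff (childEmbedding hi).injective.injOn)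
  rw [finite_past_iff hfin]
  constructor
  · exact fun h i hi hlt => (hchild i hi hlt).1 (h _ (familyTree_adj_nil.2 ⟨i, hi, rfl⟩) hlt)
  · intro h u hadj hlt
    obtain ⟨i, hi, rfl⟩ := familyTree_adj_nil.1 hadj
    exact (hchild i hi hlt).2 (h i hi hlt)

lemma rootOccupied_familyTree_iff {s : List ℕ → unitInterval} (hs : Function.Injective s)
    (hfin : (past (familyTree c) s []).Finite) :
    RootOccupied (familyTree c) s [] ↔ ∀ i < c [], s [i] < s [] →
      ¬ RootOccupied (familyTree fun u => c (i :: u)) (fun u => s (i :: u)) [] := by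
  have hchild (i : ℕ) (hi : i < c []) (hlt : s [i] < s []) : RootOccupied (familyTree c) s [i] ↔
      RootOccupied (familyTree fun u => c (i :: u)) (fun u => s (i :: u)) [] :=
    rootOccupied_embedding (childEmbedding hi) (mem_range_childEmbedding hi hlt) []
  rw [rootOccupied_iff hs hfin]
  constructor
  · intro h i hi hlt
    rw [← hchild i hi hlt]
    exact h _ (familyTree_adj_nil.2 ⟨i, hi, rfl⟩) hlt
  · intro h u hadj hlt
    obtain ⟨i, hi, rfl⟩ := familyTree_adj_nil.1 hadj
    rw [hchild i hi hlt]
    exact h i hi hlt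

end FamilyTree

/-! ### Measurability of pasts -/

section Measurability

variable {V : Type*} [Countable V]

lemma measurableSet_mem_past (v w : V) :
    MeasurableSet {p : SimpleGraph V × (V → unitInterval) | w ∈ past p.1 p.2 v} := by
  let R (p : SimpleGraph V × (V → unitInterval)) (a b : V) : Prop := p.1.Adj a b ∧ p.2 b < p.2 a
  have hR (a b : V) : Measurable fun p => R p a b :=
    .and (by fun_prop) (measurableSet_setOfPred.1 (measurableSet_lt (by fun_prop) (by fun_prop)))
  have hpath (p : SimpleGraph V × (V → unitInterval)) : w ∈ past p.1 p.2 v ↔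
      ∃ l : List V, (v :: l).IsChain (R p) ∧ (v :: l).getLast (List.cons_ne_nil _ _) = w := by
    constructor
    · exact List.exists_isChain_cons_of_relationReflTransGen
    · rintro ⟨l, hl, hw⟩
      exact List.relationReflTransGen_of_exists_isChain_cons l hl hw
  simp only [hpath, List.isChain_iff_getElem]
  refine measurableSet_setOfPred.2 (.exists fun l => .and ?_ measurable_const)
  exact .forall fun i => .forall fun _ => hR _ _

lemma measurableSet_finite_past (v : V) :
    MeasurableSet {p : SimpleGraph V × (V → unitInterval) | (past p.1 p.2 v).Finite} := by
  have hfinset (A : Set V) : A.Finite ↔ ∃ F : Finset V, ∀ w, w ∈ A → w ∈ F :=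
    ⟨fun h => ⟨h.toFinset, fun _ => h.mem_toFinset.2⟩, fun ⟨F, hF⟩ => F.finite_toSet.subset hF⟩
  simp only [hfinset]
  refine measurableSet_setOfPred.2 (.exists fun F => .forall fun w => .imp ?_ measurable_const)
  exact measurableSet_setOfPred.1 (measurableSet_mem_past v w)

lemma measurableSet_mem_greedyMIS (l : List V) (w : V) :
    MeasurableSet {G : SimpleGraph V | w ∈ greedyMIS G l} := by
  induction l using List.reverseRecOn generalizing w with
  | nil => simp only [greedyMIS_nil, Set.mem_empty_iff_false, measurableSet_setOfPred,
      measurable_const]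
  | append_singleton l a ih =>
    simp only [mem_greedyMIS_append_singleton]
    refine measurableSet_setOfPred.2 (.or (measurableSet_setOfPred.1 (ih w))
      (.and measurable_const (.forall fun u => .imp (measurableSet_setOfPred.1 (ih u)) ?_)))
    exact .not (by fun_prop)

lemma measurableSet_rootOccupied (v : V) :
    MeasurableSet {p : SimpleGraph V × (V → unitInterval) | RootOccupied p.1 p.2 v} := by
  simp only [RootOccupied, Set.ext_iff, List.pairwise_iff_getElem]
  refine measurableSet_setOfPred.2 (.exists fun l => .and (.forall fun w => ?_) (.and ?_ ?_))
  · exact .iff measurable_const (measurableSet_setOfPred.1 (measurableSet_mem_past v w))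
  · refine .forall fun i => .forall fun j => .forall fun _ => .forall fun _ => .forall fun _ => ?_
    exact measurableSet_setOfPred.1 (measurableSet_lt (by fun_prop) (by fun_prop))
  · exact (measurableSet_setOfPred.1 (measurableSet_mem_greedyMIS l v)).comp measurable_fst

end Measurability

/-! ### Infinite product measures -/

section InfinitePi

lemma infinitePi_prod_map_zip {ι α β : Type*} [MeasurableSpace α] [MeasurableSpace β]
    (μ : ι → Measure α) (ν : ι → Measure β) [∀ i, IsProbabilityMeasure (μ i)]
    [∀ i, IsProbabilityMeasure (ν i)] :
    ((Measure.infinitePi μ).prod (Measure.infinitePi ν)).map (fun p i => (p.1 i, p.2 i)) =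
      Measure.infinitePi fun i => (μ i).prod (ν i) := by
  refine ((Measure.isProjectiveLimit_infinitePi _).unique fun I => ?_).symm
  have h := (measurePreserving_arrowProdEquivProdArrow α β I (fun i => μ i)
    (fun i => ν i)).symm.map_eq
  rw [← Measure.infinitePi_map_restrict, ← Measure.infinitePi_map_restrict,
    Measure.map_prod_map _ _ (by fun_prop) (by fun_prop),
    Measure.map_map (by fun_prop) (by fun_prop)] at h
  rw [Measure.map_map (by fun_prop) (by fun_prop)]
  exact h

lemma infinitePi_map_unzip {ι α β : Type*} [MeasurableSpace α] [MeasurableSpace β]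
    (μ : ι → Measure α) (ν : ι → Measure β) [∀ i, IsProbabilityMeasure (μ i)]
    [∀ i, IsProbabilityMeasure (ν i)] :
    (Measure.infinitePi fun i => (μ i).prod (ν i)).map
        (fun ω => ((fun i => (ω i).1), fun i => (ω i).2)) =
      (Measure.infinitePi μ).prod (Measure.infinitePi ν) := by
  rw [← infinitePi_prod_map_zip, Measure.map_map (by fun_prop) (by fun_prop)]
  exact Measure.map_id

lemma infinitePi_map_prodMk {ι κ : Type*} {α : ι → Type*} [∀ i, MeasurableSpace (α i)]
    (μ : ∀ i, Measure (α i)) [∀ i, IsProbabilityMeasure (μ i)] {i : ι} {f : κ → ι}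
    (hf : Function.Injective f) (hi : i ∉ Set.range f) :
    (Measure.infinitePi μ).map (fun ω => (ω i, fun k => ω (f k))) =
      (μ i).prod (Measure.infinitePi fun k => μ (f k)) := by
  classical
  have hindep : IndepFun (fun ω : ∀ i, α i => ω i) (fun ω k => ω (f k))
      (Measure.infinitePi μ) := by
    refine IndepFun.indepFun_process (by fun_prop) (fun _ => by fun_prop) fun J => ?_
    have hdisj : Disjoint {i} (J.image f) := by
      rw [Finset.disjoint_singleton_left, Finset.mem_image]
      exact fun ⟨k, _, hk⟩ => hi ⟨k, hk⟩
    have hfinset := (iIndepFun_infinitePi (P := μ) (X := fun _ x => x)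
      fun _ => measurable_id).indepFun_finset _ _ hdisj fun _ => measurable_pi_apply _
    exact hfinset.comp
      (measurable_pi_apply (⟨i, Finset.mem_singleton_self i⟩ : ({i} : Finset ι)))
      (measurable_pi_lambda (fun x (k : J) => x ⟨f k, Finset.mem_image_of_mem f k.2⟩)
        fun _ => measurable_pi_apply _)
  rw [hindep.map_prod_eq_prod_map_map (measurable_pi_apply _).aemeasurable
    (measurable_pi_lambda _ fun _ => measurable_pi_apply _).aemeasurable,
    Measure.infinitePi_map_eval, Measure.map_infinitePi_infinitePi_of_inj hf]

lemma infinitePi_list_map_prodMk_cons {ι α : Type*} [MeasurableSpace α] (μ : Measure α)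
    [IsProbabilityMeasure μ] :
    (Measure.infinitePi fun _ : List ι => μ).map (fun ω => (ω [], fun i u => ω (i :: u))) =
      μ.prod (Measure.infinitePi fun _ : ι => Measure.infinitePi fun _ : List ι => μ) := by
  have hinj : Function.Injective fun p : ι × List ι => p.1 :: p.2 :=
    fun _ _ h => Prod.ext (List.head_eq_of_cons_eq h) (List.tail_eq_of_cons_eq h)
  have hnil : [] ∉ Set.range fun p : ι × List ι => p.1 :: p.2 :=
    fun ⟨_, h⟩ => List.cons_ne_nil _ _ h
  have hsplit := infinitePi_map_prodMk (fun _ : List ι => μ) hinj hnil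
  have hcurry := Measure.infinitePi_map_curry (fun (_ : ι) (_ : List ι) => μ)
  have hprod := Measure.map_prod_map μ (Measure.infinitePi fun _ : ι × List ι => μ)
    measurable_id (MeasurableEquiv.curry ι (List ι) α).measurable
  rw [Measure.map_id, hcurry, ← hsplit, Measure.map_map (by fun_prop) (by fun_prop)] at hprod
  exact hprod.symm

lemma infinitePi_real_forall_lt_notMem {α : Type*} [MeasurableSpace α] (μ : Measure α)
    [IsProbabilityMeasure μ] {B : Set α} (hB : MeasurableSet B) (k : ℕ) :
    (Measure.infinitePi fun _ : ℕ => μ).real {f | ∀ i < k, f i ∉ B} = (1 - μ.real B) ^ k := by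
  have hpi : {f : ℕ → α | ∀ i < k, f i ∉ B} = Set.pi (Finset.range k) fun _ => Bᶜ := by
    ext f
    simp
  rw [hpi, measureReal_def, Measure.infinitePi_pi _ fun _ _ => hB.compl, Finset.prod_const,
    Finset.card_range, ENNReal.toReal_pow, ← measureReal_def, probReal_compl_eq_one_sub hB]

end InfinitePi

lemma ae_injective_labelLaw (V : Type*) [Countable V] :
    ∀ᵐ s ∂labelLaw V, Function.Injective s := by
  have hne (v w : V) (hvw : v ≠ w) : ∀ᵐ s ∂labelLaw V, s v ≠ s w := by
    have hp : MeasurePreserving (fun s : V → unitInterval => (s v, s w)) (labelLaw V)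
        (volume.prod volume) := ⟨by fun_prop, Measure.infinitePi_map_eval_prod hvw⟩
    refine hp.quasiMeasurePreserving.ae (p := fun x => x.1 ≠ x.2) ?_
    refine (Measure.ae_prod_iff_ae_ae
      (measurableSet_eq_fun measurable_fst measurable_snd).compl).2 ?_
    exact .of_forall fun x => (Measure.ae_ne volume x).mono fun _ => Ne.symm
  have hall : ∀ᵐ s ∂labelLaw V, ∀ v w, v ≠ w → s v ≠ s w := by
    simpa only [ae_all_iff] using hne
  filter_upwards [hall] with s hs v w
  exact not_imp_not.1 (hs v w)

/-! ### Labelled Galton–Watson trees -/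

/-- A tree with labels on its vertices, encoded by the number of children and the label of every
finite sequence of natural numbers, as in `familyTree`. -/
abbrev LabelledTree : Type := List ℕ → ℕ × unitInterval

namespace LabelledTree

/-- The number of children of the vertex `v`. -/
def childCount (ω : LabelledTree) (v : List ℕ) : ℕ := (ω v).1

/-- The label of the vertex `v`. -/
def label (ω : LabelledTree) (v : List ℕ) : unitInterval := (ω v).2

/-- The labelled tree of the descendants of the `i`-th child of the root. -/
def subtree (ω : LabelledTree) (i : ℕ) : LabelledTree := fun u => ω (i :: u)

/-- The tree itself, without its labels. -/
def graph (ω : LabelledTree) : SimpleGraph (List ℕ) := familyTree ω.childCount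

/-- The event that the root has no child in its past whose labelled subtree lies in `A`. -/
def noChildIn (A : Set LabelledTree) : Set LabelledTree :=
  {ω | ∀ i < ω.childCount [], ¬ (ω.label [i] < ω.label [] ∧ ω.subtree i ∈ A)}

@[fun_prop]
lemma measurable_label (v : List ℕ) : Measurable fun ω : LabelledTree => ω.label v := by
  unfold label
  fun_prop

lemma measurable_graph_label : Measurable fun ω : LabelledTree => (ω.graph, ω.label) :=
  (measurable_familyTree.comp (measurable_pi_lambda _ fun v => by
    unfold childCount
    fun_prop)).prodMk (measurable_pi_lambda _ measurable_label)

end LabelledTree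

open LabelledTree

/-- The law of the Galton–Watson tree with offspring distribution `ν`. -/
def galtonWatson (ν : Measure ℕ) : Measure (SimpleGraph (List ℕ)) :=
  (Measure.infinitePi fun _ : List ℕ => ν).map familyTree

/-- The law of the Galton–Watson tree with offspring distribution `ν` and independent uniform
labels. -/
def labelledGaltonWatson (ν : Measure ℕ) : Measure LabelledTree :=
  Measure.infinitePi fun _ => ν.prod volume

section LabelledGaltonWatson

variable (ν : Measure ℕ) [IsProbabilityMeasure ν]

instance : IsProbabilityMeasure (labelledGaltonWatson ν) := by
  unfold labelledGaltonWatson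
  infer_instance

lemma galtonWatson_prod_labelLaw : (galtonWatson ν).prod (labelLaw (List ℕ)) =
    (labelledGaltonWatson ν).map fun ω => (ω.graph, ω.label) := by
  have h := Measure.map_prod_map (Measure.infinitePi fun _ : List ℕ => ν) (labelLaw (List ℕ))
    measurable_familyTree measurable_id
  rw [Measure.map_id] at h
  rw [galtonWatson, h, labelLaw, ← infinitePi_map_unzip, Measure.map_map
    (measurable_familyTree.prodMap measurable_id) (by fun_prop)]
  rfl

instance : IsProbabilityMeasure (galtonWatson ν) :=
  Measure.isProbabilityMeasure_map measurable_familyTree.aemeasurable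

lemma measurePreserving_label :
    MeasurePreserving label (labelledGaltonWatson ν) (labelLaw (List ℕ)) := by
  refine ⟨measurable_pi_lambda _ measurable_label, ?_⟩
  have h := (measurePreserving_snd (μ := galtonWatson ν) (ν := labelLaw (List ℕ))).map_eq
  rwa [galtonWatson_prod_labelLaw, Measure.map_map measurable_snd measurable_graph_label] at h

end LabelledGaltonWatson

/-! ### Generating functions -/

/-- The probability generating function of a distribution `ν` on the natural numbers. -/
def pgf (ν : Measure ℕ) (x : ℝ) : ℝ := ∫ k, x ^ k ∂ν

section GeneratingFunction

variable (ν : Measure ℕ) [IsFiniteMeasure ν]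

lemma integrable_pow_of_mem_Icc {x : ℝ} (hx : x ∈ Set.Icc 0 1) : Integrable (fun k => x ^ k) ν :=
  .of_bound (C := 1) (by fun_prop) <| .of_forall fun k => by
    rw [norm_pow, Real.norm_of_nonneg hx.1]
    exact pow_le_one₀ hx.1 hx.2

lemma continuousOn_pgf : ContinuousOn (pgf ν) (Set.Icc 0 1) := by
  refine continuousOn_of_dominated (bound := 1) (fun _ _ => by fun_prop)
    (fun x hx => .of_forall fun k => ?_) (integrable_const 1) (.of_forall fun _ => by fun_prop)
  rw [norm_pow, Real.norm_of_nonneg hx.1]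
  exact pow_le_one₀ hx.1 hx.2

end GeneratingFunction

lemma pgf_le_one (ν : Measure ℕ) [IsProbabilityMeasure ν] {x : ℝ} (hx : x ∈ Set.Icc 0 1) :
    pgf ν x ≤ 1 := by
  have h := integral_mono (integrable_pow_of_mem_Icc ν hx) (integrable_const 1)
    fun k => pow_le_one₀ hx.1 hx.2
  simpa [pgf] using h

lemma one_sub_pgf_one_sub_le {ν : Measure ℕ} [IsProbabilityMeasure ν]
    (hν : Integrable (fun k : ℕ => (k : ℝ)) ν) {x : ℝ} (hx : x ∈ Set.Icc 0 1) :
    1 - pgf ν (1 - x) ≤ (∫ k : ℕ, (k : ℝ) ∂ν) * x := by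
  have hpow := integrable_pow_of_mem_Icc ν (Set.Icc.one_sub_mem hx)
  calc 1 - pgf ν (1 - x) = ∫ k, (1 - (1 - x) ^ k) ∂ν := by
        simp [pgf, integral_sub (integrable_const 1) hpow]
    _ ≤ ∫ k : ℕ, (k : ℝ) * x ∂ν :=
        integral_mono ((integrable_const 1).sub hpow) (hν.mul_const x) fun k => by
          have := one_add_mul_le_pow (a := -x) (by linarith [hx.2]) k
          rw [← sub_eq_add_neg] at this
          dsimp only
          linarith
    _ = (∫ k : ℕ, (k : ℝ) ∂ν) * x := integral_mul_const x _

lemma pgf_poissonMeasure (r : ℝ≥0) (x : ℝ) :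
    pgf (poissonMeasure r) x = Real.exp (-r * (1 - x)) := by
  have h := (NormedSpace.expSeries_div_hasSum_exp ((r : ℝ) * x)).mul_left (Real.exp (-r))
  rw [← Real.exp_eq_exp_ℝ, ← Real.exp_add] at h
  rw [pgf, integral_poissonMeasure, show -r * (1 - x) = -r + r * x by ring, ← h.tsum_eq]
  refine tsum_congr fun k => ?_
  rw [smul_eq_mul, mul_pow]
  ring

lemma integrable_natCast_poissonMeasure (r : ℝ≥0) :
    Integrable (fun k : ℕ => (k : ℝ)) (poissonMeasure r) := by
  rw [integrable_poissonMeasure_iff, ← summable_nat_add_iff 1]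
  refine ((Real.summable_pow_div_factorial r).mul_left (Real.exp (-r) * r)).congr fun k => ?_
  rw [Real.norm_of_nonneg (by positivity), Nat.factorial_succ]
  push_cast
  field_simp
  ring

/-! ### The recursive distributional equation -/

lemma prod_real_eq_integral {α β : Type*} [MeasurableSpace α] [MeasurableSpace β] (μ : Measure α)
    (ν : Measure β) [IsFiniteMeasure μ] [IsFiniteMeasure ν] {s : Set (α × β)}
    (hs : MeasurableSet s) : (μ.prod ν).real s = ∫ x, ν.real (Prod.mk x ⁻¹' s) ∂μ := by
  simp only [measureReal_def]
  rw [Measure.prod_apply hs, integral_toReal (measurable_measure_prodMk_left hs).aemeasurable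
    (.of_forall fun _ => measure_lt_top ν _)]

/-- The probability, under the law of the labelled Galton–Watson tree, that the event `A` holds and
the root has label less than `t`. -/
def probBelow (ν : Measure ℕ) (A : Set LabelledTree) (t : ℝ) : ℝ :=
  (labelledGaltonWatson ν).real {ω | (ω.label [] : ℝ) < t ∧ ω ∈ A}

section ProbBelow

variable (ν : Measure ℕ) [IsProbabilityMeasure ν]

lemma probBelow_mono (A : Set LabelledTree) : Monotone (probBelow ν A) := fun _ _ h =>
  measureReal_mono fun _ hω => ⟨hω.1.trans_le h, hω.2⟩

lemma probBelow_univ {t : ℝ} (ht : t ∈ Set.Icc 0 1) : probBelow ν Set.univ t = t := by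
  have hlabel : MeasurePreserving (fun ω : LabelledTree => ω.label [])
      (labelledGaltonWatson ν) volume :=
    (measurePreserving_eval_infinitePi (fun _ : List ℕ => volume) []).comp
      (measurePreserving_label ν)
  have h := hlabel.measureReal_preimage (s := Set.Iio ⟨t, ht⟩) measurableSet_Iio.nullMeasurableSet
  rw [measureReal_def volume, unitInterval.volume_Iio, ENNReal.toReal_ofReal ht.1] at h
  refine Eq.trans ?_ h
  simp only [probBelow, Set.mem_univ, and_true]
  rfl

variable {A : Set LabelledTree}

lemma probBelow_add_compl (hA : MeasurableSet A) {t : ℝ} (ht : t ∈ Set.Icc 0 1) :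
    probBelow ν A t + probBelow ν Aᶜ t = t := by
  have h := measureReal_inter_add_sdiff (μ := labelledGaltonWatson ν)
    (s := {ω | (ω.label [] : ℝ) < t}) hA
  conv_rhs => rw [← probBelow_univ ν ht]
  simp only [probBelow, Set.mem_univ, and_true]
  exact h

lemma probBelow_one (hA : MeasurableSet A) :
    probBelow ν A 1 = (labelledGaltonWatson ν).real A := by
  have h := probBelow_add_compl ν hA (Set.right_mem_Icc.2 zero_le_one)
  have hle (B : Set LabelledTree) : probBelow ν B 1 ≤ (labelledGaltonWatson ν).real B :=
    measureReal_mono fun _ hω => hω.2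
  linarith [hle A, hle Aᶜ, probReal_add_probReal_compl (μ := labelledGaltonWatson ν) hA]

lemma probBelow_mem_Icc (t : ℝ) : probBelow ν A t ∈ Set.Icc 0 1 :=
  ⟨measureReal_nonneg, measureReal_le_one⟩

lemma lipschitzOnWith_probBelow (hA : MeasurableSet A) :
    LipschitzOnWith 1 (probBelow ν A) (Set.Icc 0 1) := by
  refine .of_le_add fun t ht u hu => ?_
  rcases le_total t u with htu | hut
  · exact (probBelow_mono ν A htu).trans (le_add_of_nonneg_right dist_nonneg)
  · rw [Real.dist_eq, abs_of_nonneg (sub_nonneg.2 hut)]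
    linarith [probBelow_mono ν Aᶜ hut, probBelow_add_compl ν hA ht, probBelow_add_compl ν hA hu]

lemma continuousOn_pgf_one_sub_probBelow (hA : MeasurableSet A) :
    ContinuousOn (fun u => pgf ν (1 - probBelow ν A u)) (Set.Icc 0 1) :=
  (continuousOn_pgf ν).comp
    (continuousOn_const.sub (lipschitzOnWith_probBelow ν hA).continuousOn)
    fun t _ => Set.Icc.one_sub_mem (probBelow_mem_Icc ν t)

lemma labelledGaltonWatson_map_root_subtree :
    (labelledGaltonWatson ν).map (fun ω => (ω [], ω.subtree)) =
      (ν.prod volume).prod (Measure.infinitePi fun _ : ℕ => labelledGaltonWatson ν) :=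
  infinitePi_list_map_prodMk_cons (ν.prod volume)

lemma infinitePi_labelledGaltonWatson_real_forall (hA : MeasurableSet A) (k : ℕ) (u : ℝ) :
    (Measure.infinitePi fun _ : ℕ => labelledGaltonWatson ν).real
        {f | ∀ i < k, ¬ (((f i).label [] : ℝ) < u ∧ f i ∈ A)} = (1 - probBelow ν A u) ^ k := by
  have hlabel : Measurable fun ω : LabelledTree => (ω.label [] : ℝ) := by fun_prop
  exact infinitePi_real_forall_lt_notMem (labelledGaltonWatson ν)
    ((measurableSet_lt hlabel measurable_const).inter hA) k

lemma infinitePi_labelledGaltonWatson_real_section (hA : MeasurableSet A) (k : ℕ) (u t : ℝ) :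
    (Measure.infinitePi fun _ : ℕ => labelledGaltonWatson ν).real
        {f | u < t ∧ ∀ i < k, ¬ (((f i).label [] : ℝ) < u ∧ f i ∈ A)} =
      (Set.Iio t).indicator (fun u => (1 - probBelow ν A u) ^ k) u := by
  by_cases hut : u < t
  · rw [Set.indicator_of_mem (Set.mem_Iio.2 hut),
      ← infinitePi_labelledGaltonWatson_real_forall ν hA]
    simp only [hut, true_and]
  · rw [Set.indicator_of_notMem (mt Set.mem_Iio.1 hut)]
    simp [hut]

lemma probBelow_noChildIn_eq_integral_prod (hA : MeasurableSet A) (t : ℝ) :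
    Integrable (fun x : ℕ × unitInterval =>
      (Set.Iio t).indicator (fun u => (1 - probBelow ν A u) ^ x.1) (x.2 : ℝ)) (ν.prod volume) ∧
    probBelow ν (noChildIn A) t = ∫ x : ℕ × unitInterval,
      (Set.Iio t).indicator (fun u => (1 - probBelow ν A u) ^ x.1) (x.2 : ℝ) ∂ν.prod volume := by
  let E : Set ((ℕ × unitInterval) × (ℕ → LabelledTree)) :=
    {p | (p.1.2 : ℝ) < t ∧ ∀ i < p.1.1, ¬ (((p.2 i).label [] : ℝ) < p.1.2 ∧ p.2 i ∈ A)}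
  have hE : MeasurableSet E := by
    refine measurableSet_setOfPred.2 (.and ?_ (.forall fun i => .imp ?_ (.not (.and ?_ ?_))))
    · exact measurableSet_setOfPred.1 (measurableSet_lt (by fun_prop) measurable_const)
    · exact measurableSet_setOfPred.1 (measurableSet_lt measurable_const (by fun_prop))
    · exact measurableSet_setOfPred.1 (measurableSet_lt (by fun_prop) (by fun_prop))
    · exact measurableSet_setOfPred.1 (hA.preimage (by fun_prop))
  have hsection (x : ℕ × unitInterval) :=
    infinitePi_labelledGaltonWatson_real_section ν hA x.1 x.2 t
  simp_rw [← hsection]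
  refine ⟨Measure.integrable_measure_prodMk_left hE (measure_ne_top _ E),
    Eq.trans ?_ (prod_real_eq_integral _ _ hE)⟩
  rw [← labelledGaltonWatson_map_root_subtree,
    map_measureReal_apply (by unfold subtree; fun_prop) hE]
  rfl

/-- Given the root, the subtrees of its children are independent copies of the whole tree. -/
lemma probBelow_noChildIn (hA : MeasurableSet A) {t : ℝ} (ht : t ∈ Set.Icc 0 1) :
    probBelow ν (noChildIn A) t = ∫ u in 0..t, pgf ν (1 - probBelow ν A u) := by
  have hset : Set.Icc 0 1 ∩ Set.Iio t = Set.Ico 0 t := by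
    rw [← Set.Ici_inter_Iic, Set.inter_assoc, Set.inter_eq_self_of_subset_right
      ((Set.Iio_subset_Iio ht.2).trans Set.Iio_subset_Iic_self), Set.Ici_inter_Iio]
  have hpgf (u : ℝ) : ∫ k, (Set.Iio t).indicator (fun u => (1 - probBelow ν A u) ^ k) u ∂ν =
      (Set.Iio t).indicator (fun u => pgf ν (1 - probBelow ν A u)) u := by
    by_cases hut : u < t <;> simp [Set.indicator, pgf, hut]
  obtain ⟨hint, hprod⟩ := probBelow_noChildIn_eq_integral_prod ν hA t
  calc probBelow ν (noChildIn A) t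
      = ∫ u : unitInterval, (Set.Iio t).indicator (fun u => pgf ν (1 - probBelow ν A u)) u := by
        rw [hprod, integral_prod_symm _ hint]
        simp only [hpgf]
    _ = ∫ u in Set.Icc 0 1, (Set.Iio t).indicator (fun u => pgf ν (1 - probBelow ν A u)) u :=
        unitInterval.measurePreserving_coe.integral_comp unitInterval.measurableEmbedding_coe _
    _ = ∫ u in 0..t, pgf ν (1 - probBelow ν A u) := by
        rw [setIntegral_indicator measurableSet_Iio, hset, intervalIntegral.integral_of_le ht.1,
          integral_Ico_eq_integral_Ioc]

end ProbBelow

/-! ### Integral equations -/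

lemma hasDerivWithinAt_of_eq_integral {f g : ℝ → ℝ} {a b : ℝ} (hg : ContinuousOn g (Set.Icc a b))
    (hf : ∀ t ∈ Set.Icc a b, f t = ∫ u in a..t, g u) {t : ℝ} (ht : t ∈ Set.Ico a b) :
    HasDerivWithinAt f (g t) (Set.Ici t) t := by
  have htI : t ∈ Set.Icc a b := Set.Ico_subset_Icc_self ht
  have hnhds : Set.Icc a b ∈ 𝓝[>] t :=
    mem_of_superset (Ioo_mem_nhdsGT ht.2) fun u hu => ⟨ht.1.trans hu.1.le, hu.2.le⟩
  have hnhds' : Set.Icc a b ∈ 𝓝[≥] t :=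
    mem_of_superset (Ico_mem_nhdsGE ht.2) fun u hu => ⟨ht.1.trans hu.1, hu.2.le⟩
  have hint : IntervalIntegrable g volume a t :=
    (hg.mono (Set.Icc_subset_Icc_right htI.2)).intervalIntegrable_of_Icc ht.1
  have hderiv := intervalIntegral.integral_hasDerivWithinAt_right (s := Set.Ici t) hint
    ⟨Set.Icc a b, hnhds, hg.aestronglyMeasurable measurableSet_Icc⟩
    ((hg t htI).mono_of_mem_nhdsWithin hnhds)
  exact hderiv.congr_of_eventuallyEq (eventually_of_mem hnhds' hf) (hf t htI)

lemma eq_zero_of_eq_integral_of_abs_le {f g : ℝ → ℝ} {a b K : ℝ}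
    (hg : ContinuousOn g (Set.Icc a b)) (hf : ∀ t ∈ Set.Icc a b, f t = ∫ u in a..t, g u)
    (hgf : ∀ t ∈ Set.Icc a b, |g t| ≤ K * |f t|) : ∀ t ∈ Set.Icc a b, f t = 0 := by
  rcases lt_or_ge b a with hba | hab
  · simp [Set.Icc_eq_empty hba.not_ge]
  have hfa : f a = 0 := by simpa using hf a (Set.left_mem_Icc.2 hab)
  have hcont : ContinuousOn f (Set.Icc a b) :=
    (intervalIntegral.continuousOn_primitive_interval' (hg.intervalIntegrable_of_Icc hab)
      Set.left_mem_uIcc |>.mono Set.Icc_subset_uIcc).congr hf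
  exact eq_zero_of_abs_deriv_le_mul_abs_self_of_eq_zero_right hcont
    (fun t ht => hasDerivWithinAt_of_eq_integral hg hf ht) hfa
    fun t ht => hgf t (Set.Ico_subset_Icc_self ht)

lemma eq_log_div_of_eq_integral_exp {r : ℝ} (hr : 0 < r) {f : ℝ → ℝ}
    (hfc : ContinuousOn f (Set.Icc 0 1))
    (hf : ∀ t ∈ Set.Icc (0 : ℝ) 1, f t = ∫ u in 0..t, Real.exp (-r * f u)) :
    f 1 = Real.log (1 + r) / r := by
  have hexp : ContinuousOn (fun u => Real.exp (-r * f u)) (Set.Icc 0 1) := by fun_prop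
  have hconst : Real.exp (r * f 1) - r * 1 = Real.exp (r * f 0) - r * 0 := by
    refine constant_of_has_deriv_right_zero (f := fun t => Real.exp (r * f t) - r * t)
      (by fun_prop) (fun t ht => ?_) 1 (Set.right_mem_Icc.2 zero_le_one)
    refine (((hasDerivWithinAt_of_eq_integral hexp hf ht).const_mul r).exp.sub
      ((hasDerivWithinAt_id t _).const_mul r)).congr_deriv ?_
    rw [mul_left_comm, ← Real.exp_add]
    simp
  have hf0 : f 0 = 0 := by simpa using hf 0 (Set.left_mem_Icc.2 zero_le_one)
  have hf1 : Real.exp (r * f 1) = 1 + r := by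
    rw [hf0] at hconst
    simp only [mul_zero, Real.exp_zero, mul_one, sub_zero] at hconst
    linarith
  rw [eq_div_iff hr.ne', ← hf1, Real.log_exp, mul_comm]

/-! ### Nonexplosive growth and the density of the root -/

namespace LabelledTree

/-- The event that the past of the root is finite. -/
def finitePast : Set LabelledTree := {ω | (past ω.graph ω.label []).Finite}

/-- The event that the root belongs to the greedy maximal independent set of its past. -/
def occupied : Set LabelledTree := {ω | RootOccupied ω.graph ω.label []}

lemma measurableSet_finitePast : MeasurableSet finitePast :=
  (measurableSet_finite_past []).preimage measurable_graph_label

lemma measurableSet_occupied : MeasurableSet occupied :=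
  (measurableSet_rootOccupied []).preimage measurable_graph_label

lemma noChildIn_compl_finitePast : noChildIn finitePastᶜ = finitePast := by
  ext ω
  simp only [noChildIn, not_and, Set.mem_compl_iff, not_not, Set.mem_ofPred_eq]
  exact finite_past_familyTree_iff.symm

end LabelledTree

section Density

variable {ν : Measure ℕ} [IsProbabilityMeasure ν]

lemma probBelow_compl_finitePast {t : ℝ} (ht : t ∈ Set.Icc 0 1) :
    probBelow ν finitePastᶜ t = ∫ u in 0..t, (1 - pgf ν (1 - probBelow ν finitePastᶜ u)) := by
  have hcont := continuousOn_pgf_one_sub_probBelow ν measurableSet_finitePast.compl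
  have hint : IntervalIntegrable (fun u => pgf ν (1 - probBelow ν finitePastᶜ u)) volume 0 t :=
    (hcont.mono (Set.Icc_subset_Icc_right ht.2)).intervalIntegrable_of_Icc ht.1
  have hfinite := probBelow_noChildIn ν measurableSet_finitePast.compl ht
  rw [noChildIn_compl_finitePast] at hfinite
  rw [intervalIntegral.integral_sub intervalIntegrable_const hint, ← hfinite,
    intervalIntegral.integral_const, smul_eq_mul, mul_one, sub_zero]
  linarith [probBelow_add_compl ν measurableSet_finitePast ht]

lemma ae_mem_finitePast (hν : Integrable (fun k : ℕ => (k : ℝ)) ν) :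
    ∀ᵐ ω ∂labelledGaltonWatson ν, ω ∈ finitePast := by
  have hcont : ContinuousOn (fun u => 1 - pgf ν (1 - probBelow ν finitePastᶜ u)) (Set.Icc 0 1) :=
    continuousOn_const.sub (continuousOn_pgf_one_sub_probBelow ν measurableSet_finitePast.compl)
  have hbound (t : ℝ) : |1 - pgf ν (1 - probBelow ν finitePastᶜ t)| ≤
      (∫ k : ℕ, (k : ℝ) ∂ν) * |probBelow ν finitePastᶜ t| := by
    have hmem := probBelow_mem_Icc ν (A := finitePastᶜ) t
    rw [abs_of_nonneg hmem.1,
      abs_of_nonneg (sub_nonneg.2 (pgf_le_one ν (Set.Icc.one_sub_mem hmem)))]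
    exact one_sub_pgf_one_sub_le hν hmem
  have hzero := eq_zero_of_eq_integral_of_abs_le hcont (fun _ => probBelow_compl_finitePast)
    (fun t _ => hbound t) 1 (Set.right_mem_Icc.2 zero_le_one)
  rw [probBelow_one ν measurableSet_finitePast.compl, measureReal_eq_zero_iff] at hzero
  exact hzero

theorem nonexplosiveGrowth_galtonWatson (hν : Integrable (fun k : ℕ => (k : ℝ)) ν) :
    NonexplosiveGrowth (galtonWatson ν) [] := by
  rw [NonexplosiveGrowth, galtonWatson_prod_labelLaw,
    ae_map_iff measurable_graph_label.aemeasurable (measurableSet_finite_past [])]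
  exact ae_mem_finitePast hν

lemma occupied_ae_eq_noChildIn (hν : Integrable (fun k : ℕ => (k : ℝ)) ν) :
    occupied =ᵐ[labelledGaltonWatson ν] noChildIn occupied := by
  have hinj := (measurePreserving_label ν).quasiMeasurePreserving.ae
    (ae_injective_labelLaw (List ℕ))
  filter_upwards [ae_mem_finitePast hν, hinj] with ω hfin hinj
  exact propext <| (rootOccupied_familyTree_iff hinj hfin).trans <|
    forall₂_congr fun _ _ => not_and.symm

lemma probBelow_occupied (hν : Integrable (fun k : ℕ => (k : ℝ)) ν) {t : ℝ}
    (ht : t ∈ Set.Icc 0 1) :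
    probBelow ν occupied t = ∫ u in 0..t, pgf ν (1 - probBelow ν occupied u) := by
  rw [← probBelow_noChildIn ν measurableSet_occupied ht]
  refine measureReal_congr ?_
  filter_upwards [occupied_ae_eq_noChildIn hν] with ω hω
  exact congrArg ((ω.label [] : ℝ) < t ∧ ·) hω

variable (ν) in
lemma rootDensity_galtonWatson :
    rootDensity (galtonWatson ν) [] = probBelow ν occupied 1 := by
  rw [rootDensity, galtonWatson_prod_labelLaw, probBelow_one ν measurableSet_occupied,
    map_measureReal_apply measurable_graph_label (measurableSet_rootOccupied [])]
  rfl

end Density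

theorem rootDensity_poissonGW {r : ℝ≥0} (hr : 0 < r) :
    rootDensity (poissonGW r) [] = Real.log (1 + r) / r := by
  refine (rootDensity_galtonWatson (poissonMeasure r)).trans ?_
  refine eq_log_div_of_eq_integral_exp (NNReal.coe_pos.2 hr)
    (lipschitzOnWith_probBelow _ measurableSet_occupied).continuousOn fun t ht => ?_
  simpa only [pgf_poissonMeasure, sub_sub_cancel] using
    probBelow_occupied (integrable_natCast_poissonMeasure r) ht

lemma tendsto_nat_mul_projIcc_div {r : ℝ} (hr : 0 ≤ r) :
    Tendsto (fun n : ℕ => n * (Set.projIcc (0 : ℝ) 1 zero_le_one (r / n) : ℝ)) atTop (𝓝 r) := by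
  refine tendsto_const_nhds.congr' ?_
  filter_upwards [eventually_ge_atTop ⌈r⌉₊, eventually_gt_atTop 0] with n hrn hn
  have hn' : (0 : ℝ) < n := Nat.cast_pos.2 hn
  rw [Set.projIcc_of_mem zero_le_one
    ⟨div_nonneg hr hn'.le, (div_le_one hn').2 ((Nat.le_ceil r).trans (Nat.cast_le.2 hrn))⟩,
    mul_div_cancel₀ r hn'.ne']

theorem mainTheorem7_general {r : ℝ≥0} (hr : 0 < r) {p : ℕ → unitInterval}
    (hp : Tendsto (fun n => n * (p n : ℝ)) atTop (𝓝 r))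
    (Q : ∀ n, Measure (Equiv.Perm (Fin n))) [∀ n, IsProbabilityMeasure (Q n)] :
    (NonexplosiveGrowth (poissonGW r) [] ∧
      rootDensity (poissonGW r) [] = Real.log (1 + r) / r) ∧
    AsympWHP (fun n => (SimpleGraph.binomialRandom (Fin n) (p n)).prod (Q n))
      (fun _ x => greedyDensity x.1 x.2) (Real.log (1 + r) / r) := by
  have hr' : (0 : ℝ) < r := NNReal.coe_pos.2 hr
  have hlog : Real.log (1 + r) / r ≠ 0 :=
    (div_pos (Real.log_pos (lt_add_of_pos_right 1 hr')) hr').ne'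
  exact ⟨⟨nonexplosiveGrowth_galtonWatson (integrable_natCast_poissonMeasure r),
    rootDensity_poissonGW hr⟩, (tendstoInProb_greedyDensity Q hr' hp).asympWHP hlog⟩

end

theorem mainTheorem7 (r : ℝ≥0) (hr : 0 < r) :
    (NonexplosiveGrowth (poissonGW r) [] ∧
      rootDensity (poissonGW r) [] = Real.log (1 + (r : ℝ)) / (r : ℝ)) ∧
    AsympWHP (binomialGraphOrderLaw r) (fun _ p => greedyDensity p.1 p.2)
      (Real.log (1 + (r : ℝ)) / (r : ℝ)) :=
  mainTheorem7_general hr (tendsto_nat_mul_projIcc_div r.2) fun n =>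
    (PMF.uniformOfFintype (Equiv.Perm (Fin n))).toMeasure
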